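/- Let $(\Omega,\mathcal F,P)$ be a complete probability space carrying a compound Poisson process with claim intensity $\beta>0$ and claim sizes of law $G$ on a Borel set $B\subset(0,\infty)$: the inter-arrival times are exponential with parameter $\beta$, the claim sizes have law $G$, and all of them are independent. Let $\mu(ds\,dy)$ be its random measure on $\mathbb R_+\times B$ (a unit mass at $(T,y)$ for every claim of size $y$ at time $T$) and $(\mathcal F_t)_{t\ge0}$ its natural filtration, completed by the $P$-null sets. Let $Y$ have law $G$. (A1) Let $f:\mathbb R_+\times\mathbb R\to\mathbb R_+$ be continuous and such that: for every $y\ge0$, $f(\cdot,y)$ is convex and non-decreasing with $f(0,y)=0$; for every $x\ge0$, $f(x,\cdot)$ is non-decreasing with $f(x,0)=0$; $f(x,y)>0$ if $x,y>0$; and $f(\cdot,y)$ is Lipschitz with a constant that does not depend on $y\ge0$. Let $0\le k_1<k_2$ and $\zeta_0>0$, and put $\nu=E[f(1,Y)]$, $a=\frac1{\zeta_0\nu}$ and $p(u)=(1+k_1)\beta\nu-(1+k_2)\beta\,E[f(1,(Y-u)^+)]$. Fix $\underline u>0$ such that $p(u)\ge\beta E[f(1,Y\wedge u)]$ for all $u\ge\underline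 u$. A strategy is a pair $(u,L)$ of real processes, where $u\ge\underline u$ is progressively measurable and $L$ is adapted, right-continuous and non-decreasing with $L_{0-}=0$ (so $L_0\ge0$ is an initial jump). For an initial fortune $x\ge0$, the fortune $X=X^{x,u,L}$ is the adapted càdlàg process which satisfies, almost surely, for all $t\ge0$, $$X_t=x+a\int_0^tX_sp(u_s)\,ds-\int_{[0,t]\times B}f(aX_{s-},y\wedge u_s)\,\mu(ds\,dy)-L_t ,$$ where $f(z,y)$ is read as $f(0,y)$ for $z<0$. The strategy is admissible for $x$, written $(u,L)\in\mathcal A(x)$, if $X$ exists and $L_t-L_{t-}\le X_{t-}$ for $dt\otimes P$-almost every $(t,\omega)$. With the discount factor $r$ and the ruin time $\tau=\inf\{t\ge0:X_t\le0\}$, the value function is $$V(x)=\sup_{(u,L)\in\mathcal A(x)}E\Big[\int_{[0,\tau]}e^{-rs}\,dL_s\Big],\qquad x\ge0,$$ where the integral includes the jumps of $L$ at the times $0$ and $\tau$ (if $\tau=\infty$, it is over $[0,\infty)$). Suppose that (A2) $r>\frac{2(1+k_1)\beta}{\zeta_0}$ holds. Then $V$ is non-decreasing; there is a constant $K>0$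 such that $V(x)\le Kx$ for all $x\ge0$ (in particular, $V$ is finite); $V$ is Lipschitz continuous on $[0,\infty)$; and $V(x+x')\le\frac{x+x'}{x}V(x)$ for all $x>0$ and $x'\ge0$. -/

import Mathlib

open MeasureTheory ProbabilityTheory Set Filter Topology
open scoped NNReal ENNReal

namespace Insurance

/-- The data of the insurance model on a probability space `(Ω, P)`.

Claims are generated by a compound Poisson process: the inter-arrival times `S n` are exponential
with parameter `β`, the claim sizes `Y n` have law `G` on `B ⊆ (0, ∞)`, and all these variables are
independent. `f n y` is the claim for `n` contracts when the covered risk is `y`; only its values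
at `n ≥ 0` matter. `k₁, k₂` are the loadings of the premium, `ζ₀` is the constant of the solvency
margin and `r` is the discount factor. -/
structure Model (Ω : Type*) [MeasurableSpace Ω] (P : Measure Ω) where
  B : Set ℝ
  measurableSet_B : MeasurableSet B
  B_subset : B ⊆ Ioi 0
  G : Measure ℝ
  isProbabilityMeasure_G : IsProbabilityMeasure G
  G_compl : G Bᶜ = 0
  β : ℝ
  β_pos : 0 < β
  S : ℕ → Ω → ℝ≥0
  Y : ℕ → Ω → ℝ
  measurable_S : ∀ n, Measurable (S n)
  measurable_Y : ∀ n, Measurable (Y n)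
  law_S : ∀ n, P.map (fun ω => (S n ω : ℝ)) = expMeasure β
  law_Y : ∀ n, P.map (Y n) = G
  indep : iIndepFun (Sum.elim (fun n ω => (S n ω : ℝ)) Y) P
  f : ℝ → ℝ → ℝ
  k₁ : ℝ
  k₂ : ℝ
  k₁_nonneg : 0 ≤ k₁
  k₁_lt_k₂ : k₁ < k₂
  ζ₀ : ℝ
  ζ₀_pos : 0 < ζ₀
  r : ℝ

/-- The assumptions on the claim function `f : ℝ₊ × ℝ → ℝ₊`. -/
structure ClaimFunction (f : ℝ → ℝ → ℝ) : Prop where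
  nonneg : ∀ x, 0 ≤ x → ∀ y, 0 ≤ f x y
  convex : ∀ y, 0 ≤ y → ConvexOn ℝ (Ici 0) (fun x => f x y)
  mono_left : ∀ y, 0 ≤ y → MonotoneOn (fun x => f x y) (Ici 0)
  zero_left : ∀ y, 0 ≤ y → f 0 y = 0
  mono_right : ∀ x, 0 ≤ x → Monotone (f x)
  zero_right : ∀ x, 0 ≤ x → f x 0 = 0
  pos : ∀ x y, 0 < x → 0 < y → 0 < f x y
  continuous : ContinuousOn (Function.uncurry f) (Ici 0 ×ˢ univ)
  lipschitz : ∃ K₀ : ℝ≥0, ∀ y, 0 ≤ y → LipschitzOnWith K₀ (fun x => f x y) (Ici 0)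

/-- A right-continuous path with left-hand limits. -/
def IsCadlagPath (g : ℝ≥0 → ℝ) : Prop :=
  ∀ t, ContinuousWithinAt g (Ici t) t ∧ ∃ l, Tendsto g (𝓝[<] t) (𝓝 l)

/-- A path `ℓ` of cumulative dividends: nondecreasing and right-continuous (hence with left-hand
limits), with the convention `ℓ (0-) = 0`, so that `ℓ 0 ≥ 0` is the initial jump. -/
structure IsDividendPath (ℓ : ℝ≥0 → ℝ) : Prop where
  mono : Monotone ℓ
  right_cont : ∀ t, ContinuousWithinAt ℓ (Ici t) t
  zero_le : 0 ≤ ℓ 0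

/-- The extension of a dividend path by `0` to negative times. Its measure `dℓ` charges `{0}` with
the initial jump `ℓ 0`. -/
noncomputable def IsDividendPath.stieltjes {ℓ : ℝ≥0 → ℝ} (h : IsDividendPath ℓ) :
    StieltjesFunction ℝ where
  toFun t := if t < 0 then 0 else ℓ t.toNNReal
  mono' := by
    intro s t hst
    dsimp only
    split_ifs with hs ht
    · exact le_rfl
    · exact h.zero_le.trans (h.mono bot_le)
    · linarith
    · exact h.mono (Real.toNNReal_le_toNNReal hst)
  right_continuous' := by
    intro t
    rcases lt_or_ge t 0 with ht | ht
    · have : (fun s : ℝ => if s < 0 then 0 else ℓ s.toNNReal) =ᶠ[𝓝 t] fun _ => (0 : ℝ) := by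
        filter_upwards [Iio_mem_nhds ht] with s hs
        exact if_pos hs
      exact (continuousAt_const.congr this.symm).continuousWithinAt
    · have h1 : ContinuousWithinAt (fun s : ℝ => ℓ s.toNNReal) (Ici t) t :=
        (h.right_cont t.toNNReal).comp continuous_real_toNNReal.continuousWithinAt
          (fun s hs => Real.toNNReal_le_toNNReal hs)
      refine h1.congr (fun s hs => ?_) ?_
      · exact if_neg (not_lt.2 (ht.trans hs))
      · exact if_neg (not_lt.2 ht)

namespace Model

variable {Ω : Type*} [MeasurableSpace Ω] {P : Measure Ω}

/-- The time of the `n`-th claim (counted from `0`). -/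
noncomputable def claimTime (M : Model Ω P) (n : ℕ) (ω : Ω) : ℝ≥0 :=
  ∑ i ∈ Finset.range (n + 1), M.S i ω

/-- The random measure `μ(ds dy)` on `ℝ₊ × B` of the compound Poisson process: a unit mass at
`(T, y)` for every claim of size `y` at time `T`. -/
noncomputable def claimMeasure (M : Model Ω P) (ω : Ω) : Measure (ℝ≥0 × ℝ) :=
  (Measure.sum fun n => Measure.dirac (M.claimTime n ω, M.Y n ω)).restrict (univ ×ˢ M.B)

theorem measurable_claimTime (M : Model Ω P) (n : ℕ) : Measurable (M.claimTime n) :=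
  Finset.measurable_fun_sum _ fun i _ => M.measurable_S i

theorem measurable_claimMeasure (M : Model Ω P) {C : Set (ℝ≥0 × ℝ)} (hC : MeasurableSet C) :
    Measurable fun ω => M.claimMeasure ω C := by
  have hC' : MeasurableSet (C ∩ univ ×ˢ M.B) :=
    hC.inter (MeasurableSet.univ.prod M.measurableSet_B)
  have : ∀ ω, M.claimMeasure ω C = ∑' n, (C ∩ univ ×ˢ M.B).indicator 1
      (M.claimTime n ω, M.Y n ω) := by
    intro ω
    simp only [claimMeasure, Measure.restrict_apply hC, Measure.sum_apply _ hC',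
      Measure.dirac_apply' _ hC']
  simp only [this]
  refine Measurable.tsum fun n => ?_
  exact (measurable_one.indicator hC').comp ((M.measurable_claimTime n).prodMk (M.measurable_Y n))

/-- The natural filtration of the random measure, completed by the `P`-null sets: the σ-algebra at
time `t` is generated by the variables `μ(C)`, `C ⊆ [0, t] × ℝ`, and by the null sets. -/
noncomputable def filtration [P.IsComplete] (M : Model Ω P) :
    Filtration ℝ≥0 (inferInstance : MeasurableSpace Ω) where
  seq t := (⨆ C ∈ {C : Set (ℝ≥0 × ℝ) | MeasurableSet C ∧ C ⊆ Iic t ×ˢ univ},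
      MeasurableSpace.comap (fun ω => M.claimMeasure ω C) inferInstance) ⊔
    MeasurableSpace.generateFrom {N | P N = 0}
  mono' := by
    intro s t hst
    refine sup_le_sup_right (iSup₂_le fun C hC => ?_) _
    exact le_iSup₂_of_le C
      ⟨hC.1, hC.2.trans (prod_mono (Iic_subset_Iic.2 hst) Subset.rfl)⟩ le_rfl
  le' := by
    intro t
    refine sup_le (iSup₂_le fun C hC => ?_) ?_
    · exact (M.measurable_claimMeasure hC.1).comap_le
    · exact MeasurableSpace.generateFrom_le fun N hN => measurableSet_of_null hN

/-- `ν = E[f(1, Y)]`, the average claim per contract. -/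
noncomputable def ν (M : Model Ω P) : ℝ := ∫ y, M.f 1 y ∂M.G

/-- `a = 1 / (ζ₀ ν)`: with fortune `X`, the company holds the maximal number `a X` of contracts. -/
noncomputable def a (M : Model Ω P) : ℝ := 1 / (M.ζ₀ * M.ν)

/-- The premium rate per contract at retention level `u`. -/
noncomputable def premium (M : Model Ω P) (u : ℝ) : ℝ :=
  (1 + M.k₁) * M.β * M.ν - (1 + M.k₂) * M.β * ∫ y, M.f 1 (max (y - u) 0) ∂M.G

/-- `u₀ > 0` is a lower bound for the retention levels that makes the premium cover the expected
expenditures for every larger retention level. -/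
def IsRetentionBound (M : Model Ω P) (u₀ : ℝ) : Prop :=
  0 < u₀ ∧ ∀ u, u₀ ≤ u → M.β * ∫ y, M.f 1 (min y u) ∂M.G ≤ M.premium u

/-- A pair `(u, L)` of adapted processes: a retention level `u ≥ u₀`, and cumulative dividends `L`
whose paths are càdlàg and nondecreasing with `L (0-) = 0`. The retention level is progressively
measurable, so that the integrals along its paths are defined and adapted. -/
structure Strategy [P.IsComplete] (M : Model Ω P) (u₀ : ℝ) where
  u : ℝ≥0 → Ω → ℝ
  L : ℝ≥0 → Ω → ℝ
  progressive_u : IsStronglyProgressive M.filtration u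
  le_u : ∀ t ω, u₀ ≤ u t ω
  adapted_L : StronglyAdapted M.filtration L
  path_L : ∀ ω, IsDividendPath fun t => L t ω

/-- `X` is the fortune of the company with initial fortune `x` and strategy `(u, L)`: an adapted
càdlàg process with, almost surely for all `t ≥ 0`,
`X_t = x + a ∫₀ᵗ X_s p(u_s) ds - ∫_{[0,t] × B} f(a X_{s-}, y ∧ u_s) μ(ds dy) - L_t`.
The function `f(·, y)` is extended by `f(0, y)` to negative arguments. -/
structure IsFortune [P.IsComplete] (M : Model Ω P) {u₀ : ℝ} (x : ℝ≥0) (s : M.Strategy u₀)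
    (X : ℝ≥0 → Ω → ℝ) : Prop where
  adapted : StronglyAdapted M.filtration X
  cadlag : ∀ ω, IsCadlagPath fun t => X t ω
  equation : ∀ᵐ ω ∂P, ∀ t : ℝ≥0,
    X t ω = x + M.a * (∫ v in (0 : ℝ)..t, X v.toNNReal ω * M.premium (s.u v.toNNReal ω))
      - (∫ z in Iic t ×ˢ univ,
          M.f (max 0 (M.a * Function.leftLim (fun v => X v ω) z.1)) (min z.2 (s.u z.1 ω))
          ∂M.claimMeasure ω)
      - s.L t ω

/-- The strategy is admissible for the fortune process `X`: `L_t - L_{t-} ≤ X_{t-}` for almost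
every `(t, ω)`. -/
def IsAdmissible [P.IsComplete] (M : Model Ω P) {u₀ : ℝ} (s : M.Strategy u₀)
    (X : ℝ≥0 → Ω → ℝ) : Prop :=
  ∀ᵐ z ∂((volume.restrict (Ici (0 : ℝ))).prod P),
    s.L z.1.toNNReal z.2 - Function.leftLim (fun v => s.L v z.2) z.1.toNNReal
      ≤ Function.leftLim (fun v => X v z.2) z.1.toNNReal

/-- The ruin time `inf {t ≥ 0 : X_t ≤ 0}`, which is `∞` if there is no such `t`. -/
noncomputable def ruinTime (X : ℝ≥0 → Ω → ℝ) (ω : Ω) : ℝ≥0∞ :=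
  ⨅ (t : ℝ≥0) (_ : X t ω ≤ 0), (t : ℝ≥0∞)

/-- The expected discounted dividends `E[∫_{[0, τ]} e^{-r s} dL_s]` up to the ruin time `τ`. -/
noncomputable def payoff [P.IsComplete] (M : Model Ω P) {u₀ : ℝ} (s : M.Strategy u₀)
    (X : ℝ≥0 → Ω → ℝ) : ℝ≥0∞ :=
  ∫⁻ ω, ∫⁻ t in {t : ℝ | 0 ≤ t ∧ ENNReal.ofReal t ≤ ruinTime X ω},
    ENNReal.ofReal (Real.exp (-(M.r * t))) ∂(s.path_L ω).stieltjes.measure ∂P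

/-- The value function: the supremum of the expected discounted dividends over all strategies that
are admissible for the initial fortune `x`. -/
noncomputable def value [P.IsComplete] (M : Model Ω P) (u₀ : ℝ) (x : ℝ≥0) : ℝ≥0∞ :=
  ⨆ (s : M.Strategy u₀) (X : ℝ≥0 → Ω → ℝ) (_ : M.IsFortune x s X) (_ : M.IsAdmissible s X),
    M.payoff s X

end Model

end Insurance

namespace Insurance

/-! In fact `V(x) = x`, and all four claims follow at once. Claims only lower the fortune, and
premiums make it grow at rate at most `c = (1 + k₁) β / ζ₀`. Admissibility keeps it nonnegative, so
almost surely `X_t + L_t ≤ x + c ∫₀ᵗ X`. Waiting therefore cannot pay when `r ≥ c`: integrating this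
against `r e^{-rt} dt` and using Tonelli, the `X` terms cancel and `∫ e^{-rt} dL_t ≤ x` remains
(`IsDividendPath.lintegral_exp_neg_le`, then `IsFortune.payoff_le`). Conversely, paying out `x` at
time `0` earns exactly `x` (`payoff_payAll`). -/

/-! ### Regularity of càdlàg paths -/

theorem measurable_of_continuousWithinAt_Ici {g : ℝ → ℝ}
    (hg : ∀ t, ContinuousWithinAt g (Ici t) t) : Measurable g := by
  -- Sampling at the next grid point of mesh `1 / (n + 1)`; the `+ 1` after the floor makes the
  -- sample points approach `t` from the right.
  have hq : ∀ n : ℕ, Measurable fun t : ℝ => g ((⌊((n : ℝ) + 1) * t⌋ + 1) / ((n : ℝ) + 1)) := by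
    intro n
    have h1 : Measurable fun k : ℤ => g ((k + 1) / ((n : ℝ) + 1)) := measurable_from_top
    exact h1.comp (Int.measurable_floor.comp (measurable_const_mul _))
  refine measurable_of_tendsto_metrizable hq (tendsto_pi_nhds.2 fun t => ?_)
  have hlow : ∀ n : ℕ, t ≤ (⌊((n : ℝ) + 1) * t⌋ + 1) / ((n : ℝ) + 1) := by
    intro n
    rw [le_div_iff₀ (by positivity)]
    linarith [(Int.lt_floor_add_one (((n : ℝ) + 1) * t)).le]
  have hupp : ∀ n : ℕ, (⌊((n : ℝ) + 1) * t⌋ + 1) / ((n : ℝ) + 1) ≤ t + 1 / ((n : ℝ) + 1) := by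
    intro n
    have hn : (0 : ℝ) < (n : ℝ) + 1 := by positivity
    rw [div_le_iff₀ hn, add_mul t, one_div, inv_mul_cancel₀ hn.ne']
    linarith [Int.floor_le (((n : ℝ) + 1) * t)]
  have hlim : Tendsto (fun n : ℕ => (⌊((n : ℝ) + 1) * t⌋ + 1) / ((n : ℝ) + 1)) atTop (𝓝 t) := by
    refine tendsto_of_tendsto_of_tendsto_of_le_of_le tendsto_const_nhds ?_ hlow hupp
    simpa using tendsto_const_nhds.add (tendsto_one_div_add_atTop_nhds_zero_nat (𝕜 := ℝ))
  exact (hg t).tendsto.comp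
    (tendsto_nhdsWithin_iff.2 ⟨hlim, Eventually.of_forall fun n => hlow n⟩)

namespace IsCadlagPath

variable {g : ℝ≥0 → ℝ}

theorem continuousWithinAt_toNNReal (hg : IsCadlagPath g) (t : ℝ) :
    ContinuousWithinAt (fun v : ℝ => g v.toNNReal) (Ici t) t :=
  (hg t.toNNReal).1.comp continuous_real_toNNReal.continuousWithinAt
    fun _ hs => Real.toNNReal_le_toNNReal hs

theorem measurable_toNNReal (hg : IsCadlagPath g) : Measurable fun v : ℝ => g v.toNNReal :=
  measurable_of_continuousWithinAt_Ici hg.continuousWithinAt_toNNReal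

theorem exists_tendsto_left_toNNReal (hg : IsCadlagPath g) (t : ℝ) :
    ∃ l, Tendsto (fun v : ℝ => g v.toNNReal) (𝓝[<] t) (𝓝 l) := by
  rcases le_or_gt t 0 with ht | ht
  · refine ⟨g 0, tendsto_const_nhds.congr' ?_⟩
    filter_upwards [self_mem_nhdsWithin] with v hv
    rw [Real.toNNReal_of_nonpos ((mem_Iio.1 hv).le.trans ht)]
  · obtain ⟨l, hl⟩ := (hg t.toNNReal).2
    refine ⟨l, hl.comp (tendsto_nhdsWithin_iff.2
      ⟨continuous_real_toNNReal.continuousAt.mono_left nhdsWithin_le_nhds, ?_⟩)⟩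
    filter_upwards [self_mem_nhdsWithin] with v hv
    exact (Real.toNNReal_lt_toNNReal_iff ht).2 hv

/-- One-sided limits bound the path on each side of every point. -/
theorem locallyIntegrable_toNNReal (hg : IsCadlagPath g) :
    LocallyIntegrable (fun v : ℝ => g v.toNNReal) := by
  intro t
  have hm : ∀ l : Filter ℝ, StronglyMeasurableAtFilter (fun v : ℝ => g v.toNNReal) l volume :=
    fun l => hg.measurable_toNNReal.stronglyMeasurable.stronglyMeasurableAtFilter
  have hfin : ∀ s : Set ℝ, volume.FiniteAtFilter (𝓝[s] t) := fun s =>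
    (Measure.finiteAt_nhds volume t).filter_mono nhdsWithin_le_nhds
  obtain ⟨l, hl⟩ := hg.exists_tendsto_left_toNNReal t
  rw [← nhdsLT_sup_nhdsGE, IntegrableAtFilter.sup_iff]
  exact ⟨(hfin _).integrableAtFilter_of_tendsto (hm _) hl,
    (hfin _).integrableAtFilter_of_tendsto (hm _) (hg.continuousWithinAt_toNNReal t)⟩

/-- A càdlàg path whose left-hand limits are nonnegative at almost every time is nonnegative. -/
theorem nonneg_of_ae_leftLim_nonneg (hg : IsCadlagPath g)
    (h : ∀ᵐ t ∂(volume.restrict (Ici (0 : ℝ))), 0 ≤ Function.leftLim g t.toNNReal) (t : ℝ≥0) :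
    0 ≤ g t := by
  by_contra! hneg
  -- By right-continuity a negative value persists on some `[t, b)`. The left limits on `(t, b)` are
  -- then at most `g t / 2 < 0`, on a set of positive measure.
  have h1 : ∀ᶠ v in 𝓝[≥] (t : ℝ), g v.toNNReal < g t / 2 := by
    have := hg.continuousWithinAt_toNNReal t
    refine this.tendsto.eventually_lt_const ?_
    rw [Real.toNNReal_coe]
    linarith
  obtain ⟨b, hb, hsub⟩ := mem_nhdsGE_iff_exists_Ico_subset.1 h1
  have htb : (t : ℝ) < b := hb
  have hnull : volume (Ioo (t : ℝ) b) = 0 := by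
    refine measure_mono_null (fun v hv => ?_) ((ae_restrict_iff' measurableSet_Ici).1 h)
    have hv0 : 0 < v := t.2.trans_lt hv.1
    simp only [mem_compl_iff, mem_ofPred_eq, not_forall]
    refine ⟨hv0.le, not_le.2 ?_⟩
    obtain ⟨l, hl⟩ := (hg v.toNNReal).2
    have hv0' : (0 : ℝ≥0) < v.toNNReal := Real.toNNReal_pos.2 hv0
    have : (𝓝[<] v.toNNReal).NeBot := nhdsLT_neBot_of_exists_lt ⟨0, hv0'⟩
    rw [leftLim_eq_of_tendsto hl]
    have hle : l ≤ g t / 2 := by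
      refine le_of_tendsto hl ?_
      have htv : t < v.toNNReal := by
        rw [← NNReal.coe_lt_coe, Real.coe_toNNReal v hv0.le]
        exact hv.1
      filter_upwards [Ioo_mem_nhdsLT htv] with w hw
      have : (w : ℝ) ∈ Ico (t : ℝ) b := by
        refine ⟨hw.1.le, lt_trans ?_ hv.2⟩
        rw [← Real.coe_toNNReal v hv0.le]
        exact hw.2
      have := hsub this
      simp only [mem_ofPred_eq, Real.toNNReal_coe] at this
      exact this.le
    linarith
  rw [Real.volume_Ioo, ENNReal.ofReal_eq_zero] at hnull
  linarith

end IsCadlagPath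

/-! ### Discounted integrals and the pathwise bound on dividends -/

theorem lintegral_exp_neg_Ioi {r : ℝ} (hr : 0 < r) (s : ℝ) :
    ∫⁻ t in Ioi s, ENNReal.ofReal (r * Real.exp (-(r * t))) =
      ENNReal.ofReal (Real.exp (-(r * s))) := by
  have hi : IntegrableOn (fun t => r * Real.exp (-(r * t))) (Ioi s) := by
    have h := (integrableOn_exp_mul_Ioi (neg_lt_zero.2 hr) s).const_mul r
    simp only [neg_mul] at h
    exact h
  rw [← ofReal_integral_eq_lintegral_ofReal hi (Eventually.of_forall fun t => by positivity)]
  have h := integral_exp_mul_Ioi (neg_lt_zero.2 hr) s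
  simp only [neg_mul] at h
  rw [integral_const_mul, h]
  congr 1
  field_simp

/-- Integration by parts for discounted integrals. -/
theorem lintegral_exp_neg_eq {r : ℝ} (hr : 0 < r) (m : Measure ℝ) [SFinite m] :
    ∫⁻ s in Ici 0, ENNReal.ofReal (Real.exp (-(r * s))) ∂m =
      ∫⁻ t in Ioi 0, ENNReal.ofReal (r * Real.exp (-(r * t))) * m (Ico 0 t) := by
  have hme : Measurable fun t : ℝ => ENNReal.ofReal (r * Real.exp (-(r * t))) := by fun_prop
  have hF : Measurable (Function.uncurry fun s t : ℝ =>
      {p : ℝ × ℝ | p.1 < p.2}.indicator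
        (fun p => ENNReal.ofReal (r * Real.exp (-(r * p.2)))) (s, t)) :=
    (hme.comp measurable_snd).indicator (measurableSet_lt measurable_fst measurable_snd)
  -- Write `e^{-rs} = ∫_s^∞ r e^{-rt} dt` and apply Tonelli on `{s < t}`.
  calc ∫⁻ s in Ici 0, ENNReal.ofReal (Real.exp (-(r * s))) ∂m
      = ∫⁻ s in Ici 0, (∫⁻ t in Ioi 0, {p : ℝ × ℝ | p.1 < p.2}.indicator
          (fun p => ENNReal.ofReal (r * Real.exp (-(r * p.2)))) (s, t)) ∂m := by
        refine setLIntegral_congr_fun measurableSet_Ici fun s hs => ?_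
        have h1 : (fun t : ℝ => {p : ℝ × ℝ | p.1 < p.2}.indicator
            (fun p => ENNReal.ofReal (r * Real.exp (-(r * p.2)))) (s, t)) =
            (Ioi s).indicator fun t => ENNReal.ofReal (r * Real.exp (-(r * t))) := by
          ext t
          simp [indicator]
        simp only [h1]
        rw [setLIntegral_indicator measurableSet_Ioi,
          inter_eq_self_of_subset_left (Ioi_subset_Ioi (mem_Ici.1 hs)), lintegral_exp_neg_Ioi hr]
    _ = ∫⁻ t in Ioi 0, ∫⁻ s in Ici 0, {p : ℝ × ℝ | p.1 < p.2}.indicator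
          (fun p => ENNReal.ofReal (r * Real.exp (-(r * p.2)))) (s, t) ∂m :=
        lintegral_lintegral_swap (μ := m.restrict (Ici 0)) (ν := volume.restrict (Ioi 0))
          hF.aemeasurable
    _ = _ := by
        refine lintegral_congr fun t => ?_
        have h1 : (fun s : ℝ => {p : ℝ × ℝ | p.1 < p.2}.indicator
            (fun p => ENNReal.ofReal (r * Real.exp (-(r * p.2)))) (s, t)) =
            (Iio t).indicator fun _ => ENNReal.ofReal (r * Real.exp (-(r * t))) := by
          ext s
          simp [indicator]
        simp only [h1]
        rw [setLIntegral_indicator measurableSet_Iio, setLIntegral_const, inter_comm,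
          Ici_inter_Iio]

theorem IsDividendPath.measure_Icc_zero {ℓ : ℝ≥0 → ℝ} (h : IsDividendPath ℓ) (t : ℝ) (ht : 0 ≤ t) :
    h.stieltjes.measure (Icc 0 t) = ENNReal.ofReal (ℓ t.toNNReal) := by
  -- The extension vanishes at negative times, so the initial jump is counted.
  have h0 : Function.leftLim h.stieltjes 0 = 0 := by
    refine leftLim_eq_of_tendsto (tendsto_const_nhds.congr' ?_)
    filter_upwards [self_mem_nhdsWithin] with v hv
    exact (if_pos hv).symm
  rw [StieltjesFunction.measure_Icc, h0, sub_zero]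
  congr 1
  exact if_neg (not_lt.2 ht)

/-- If a nonnegative fortune grows at rate at most `c` apart from the dividends, then the total of
the dividends discounted at a rate `r ≥ c` is at most the initial fortune. -/
theorem IsDividendPath.lintegral_exp_neg_le {ℓ : ℝ≥0 → ℝ} (h : IsDividendPath ℓ) {X : ℝ≥0 → ℝ}
    (hX : IsCadlagPath X) (hX0 : ∀ t, 0 ≤ X t) {x c r : ℝ} (hx : 0 ≤ x) (hc : 0 ≤ c) (hcr : c ≤ r)
    (hr : 0 < r) (hle : ∀ t : ℝ≥0, X t + ℓ t ≤ x + c * ∫ v in (0 : ℝ)..t, X v.toNNReal) :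
    ∫⁻ t in Ici 0, ENNReal.ofReal (Real.exp (-(r * t))) ∂h.stieltjes.measure
      ≤ ENNReal.ofReal x := by
  set e : ℝ → ℝ≥0∞ := fun t => ENNReal.ofReal (Real.exp (-(r * t))) with he
  have hem : Measurable e := by fun_prop
  have hre : ∀ t, ENNReal.ofReal (r * Real.exp (-(r * t))) = ENNReal.ofReal r * e t :=
    fun t => ENNReal.ofReal_mul hr.le
  set g : ℝ → ℝ≥0∞ := fun v => ENNReal.ofReal (X v.toNNReal) with hg
  have hgm : Measurable g := hX.measurable_toNNReal.ennreal_ofReal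
  have hℓ0 : ∀ t, 0 ≤ ℓ t := fun t => h.zero_le.trans (h.mono bot_le)
  -- The horizon is cut at `T` so that `A = ∫₀ᵀ e^{-rt} X_t dt` is finite and `r A` can be cancelled
  -- in `hsum`.
  have key : ∀ T : ℝ, ∫⁻ t in Ioc 0 T, ENNReal.ofReal r * e t * ENNReal.ofReal (ℓ t.toNNReal)
      ≤ ENNReal.ofReal x := by
    intro T
    set m : Measure ℝ := (volume.restrict (Ioc 0 T)).withDensity g with hm
    set A := ∫⁻ t in Ioc 0 T, e t * g t with hA
    have hAtop : A ≠ ∞ := by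
      have hi : IntegrableOn (fun v : ℝ => X v.toNNReal) (Ioc 0 T) :=
        (hX.locallyIntegrable_toNNReal.integrableOn_isCompact isCompact_Icc).mono_set
          Ioc_subset_Icc_self
      refine ne_top_of_le_ne_top hi.lintegral_lt_top.ne
        (setLIntegral_mono hgm fun t ht => ?_)
      refine mul_le_of_le_one_left (_root_.zero_le) ?_
      rw [he]
      simp only [ENNReal.ofReal_le_one, Real.exp_le_one_iff, neg_nonpos]
      exact mul_nonneg hr.le ht.1.le
    -- Integration by parts for the measure `X_v dv` on `(0, T]`.
    have hAm : A = ∫⁻ t in Ioi 0, ENNReal.ofReal r * e t * m (Ico 0 t) := by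
      have := lintegral_exp_neg_eq hr m
      simp only [hre] at this
      rw [← this, hm, restrict_withDensity measurableSet_Ici,
        lintegral_withDensity_eq_lintegral_mul _ hgm hem,
        Measure.restrict_restrict measurableSet_Ici,
        inter_eq_self_of_subset_right (fun t ht => ht.1.le)]
      simp only [hA, Pi.mul_apply, mul_comm]
    have hpt : ∀ t ∈ Ioc 0 T, ENNReal.ofReal r * e t * g t
        + ENNReal.ofReal r * e t * ENNReal.ofReal (ℓ t.toNNReal)
        ≤ ENNReal.ofReal r * e t * ENNReal.ofReal x
          + ENNReal.ofReal c * (ENNReal.ofReal r * e t * m (Ico 0 t)) := by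
      intro t ht
      have h1 := hle t.toNNReal
      rw [Real.coe_toNNReal t ht.1.le, intervalIntegral.integral_of_le ht.1.le] at h1
      have hi : IntegrableOn (fun v : ℝ => X v.toNNReal) (Ioc 0 t) :=
        (hX.locallyIntegrable_toNNReal.integrableOn_isCompact isCompact_Icc).mono_set
          Ioc_subset_Icc_self
      have h2 : ENNReal.ofReal (∫ v in Ioc 0 t, X v.toNNReal) = m (Ico 0 t) := by
        rw [ofReal_integral_eq_lintegral_ofReal hi (Eventually.of_forall fun v => hX0 _), hm,
          withDensity_apply _ measurableSet_Ico, Measure.restrict_restrict measurableSet_Ico]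
        have : Ico 0 t ∩ Ioc 0 T = Ioo 0 t := by
          ext v
          simp only [mem_inter_iff, mem_Ico, mem_Ioc, mem_Ioo]
          constructor
          · rintro ⟨⟨_, h2⟩, h3, _⟩
            exact ⟨h3, h2⟩
          · rintro ⟨h3, h4⟩
            exact ⟨⟨h3.le, h4⟩, h3, h4.le.trans ht.2⟩
        rw [this, restrict_Ioo_eq_restrict_Ioc]
      have h3 : g t + ENNReal.ofReal (ℓ t.toNNReal)
          ≤ ENNReal.ofReal x + ENNReal.ofReal c * m (Ico 0 t) := by
        rw [← h2, ← ENNReal.ofReal_mul hc, hg, ← ENNReal.ofReal_add (hX0 _) (hℓ0 _),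
          ← ENNReal.ofReal_add hx (mul_nonneg hc (integral_nonneg fun v => hX0 _))]
        exact ENNReal.ofReal_le_ofReal h1
      calc _ = ENNReal.ofReal r * e t * (g t + ENNReal.ofReal (ℓ t.toNNReal)) := by ring
        _ ≤ ENNReal.ofReal r * e t * (ENNReal.ofReal x + ENNReal.ofReal c * m (Ico 0 t)) := by
            gcongr
        _ = _ := by ring
    have hone : ∫⁻ t in Ioc 0 T, ENNReal.ofReal r * e t ≤ 1 := by
      refine (lintegral_mono_set Ioc_subset_Ioi_self).trans ?_
      simp only [← hre]
      rw [lintegral_exp_neg_Ioi hr]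
      simp
    have hmm : Measurable fun t => m (Ico 0 t) := by
      refine Monotone.measurable fun s t hst => ?_
      exact measure_mono (Ico_subset_Ico_right hst)
    -- The double integral on the right is at most `c A` by `hAm`, and `c ≤ r`.
    have hsum : ENNReal.ofReal r * A
        + ∫⁻ t in Ioc 0 T, ENNReal.ofReal r * e t * ENNReal.ofReal (ℓ t.toNNReal)
        ≤ ENNReal.ofReal r * A + ENNReal.ofReal x := by
      calc _ = ∫⁻ t in Ioc 0 T, (ENNReal.ofReal r * e t * g t
            + ENNReal.ofReal r * e t * ENNReal.ofReal (ℓ t.toNNReal)) := by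
            rw [lintegral_add_left (by fun_prop), hA,
              ← lintegral_const_mul _ (show Measurable fun t => e t * g t by fun_prop)]
            simp only [mul_assoc]
        _ ≤ ∫⁻ t in Ioc 0 T, (ENNReal.ofReal r * e t * ENNReal.ofReal x
            + ENNReal.ofReal c * (ENNReal.ofReal r * e t * m (Ico 0 t))) :=
            setLIntegral_mono' measurableSet_Ioc hpt
        _ = (∫⁻ t in Ioc 0 T, ENNReal.ofReal r * e t) * ENNReal.ofReal x
            + ENNReal.ofReal c * ∫⁻ t in Ioc 0 T, ENNReal.ofReal r * e t * m (Ico 0 t) := by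
            rw [lintegral_add_left ((hem.const_mul _).mul_const _),
              lintegral_mul_const _ (hem.const_mul _),
              lintegral_const_mul _ (show Measurable fun t => ENNReal.ofReal r * e t * m (Ico 0 t) from
                (hem.const_mul _).mul hmm)]
        _ ≤ 1 * ENNReal.ofReal x + ENNReal.ofReal r * A := by
            rw [hAm]
            gcongr
            exact Ioc_subset_Ioi_self
        _ = _ := by ring
    exact (ENNReal.add_le_add_iff_left (ENNReal.mul_ne_top ENNReal.ofReal_ne_top hAtop)).1 hsum
  rw [lintegral_exp_neg_eq hr]
  have hU : Ioi (0 : ℝ) = ⋃ n : ℕ, Ioc (0 : ℝ) n := by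
    ext t
    simp only [mem_Ioi, mem_iUnion, mem_Ioc]
    exact ⟨fun ht => (exists_nat_ge t).imp fun n hn => ⟨ht, hn⟩, fun ⟨n, hn⟩ => hn.1⟩
  -- After integration by parts for `dℓ`, the mass of `[0, t)` is at most that of `[0, t]`, which is
  -- `ℓ t`.
  calc _ ≤ ∫⁻ t in Ioi 0, ENNReal.ofReal r * e t * ENNReal.ofReal (ℓ t.toNNReal) := by
        refine setLIntegral_mono' measurableSet_Ioi fun t ht => ?_
        rw [hre, ← h.measure_Icc_zero t (le_of_lt ht)]
        gcongr
        exact Ico_subset_Icc_self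
    _ = ⨆ n : ℕ, ∫⁻ t in Ioc 0 (n : ℝ), ENNReal.ofReal r * e t * ENNReal.ofReal (ℓ t.toNNReal) := by
        rw [hU, setLIntegral_iUnion_of_directed]
        exact directed_of_isDirected_le fun i j hij =>
          Ioc_subset_Ioc_right (Nat.cast_le.2 hij)
    _ ≤ _ := iSup_le fun n => key n

theorem leftLim_const (b : ℝ) (t : ℝ≥0) : Function.leftLim (fun _ : ℝ≥0 => b) t = b :=
  continuousWithinAt_const.leftLim_eq

/-! ### Value of the model: upper bound and optimal strategy -/

namespace Model

variable {Ω : Type*} [MeasurableSpace Ω] {P : Measure Ω}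

theorem ν_nonneg (M : Model Ω P) (hf : ClaimFunction M.f) : 0 ≤ M.ν :=
  integral_nonneg fun y => hf.nonneg 1 zero_le_one y

theorem a_nonneg (M : Model Ω P) (hf : ClaimFunction M.f) : 0 ≤ M.a :=
  one_div_nonneg.2 (mul_nonneg M.ζ₀_pos.le (M.ν_nonneg hf))

theorem premium_le (M : Model Ω P) (hf : ClaimFunction M.f) (u : ℝ) :
    M.premium u ≤ (1 + M.k₁) * M.β * M.ν := by
  have h : 0 ≤ ∫ y, M.f 1 (max (y - u) 0) ∂M.G :=
    integral_nonneg fun y => hf.nonneg 1 zero_le_one _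
  have h2 : 0 ≤ 1 + M.k₂ := by linarith [M.k₁_nonneg, M.k₁_lt_k₂]
  have := mul_nonneg (mul_nonneg h2 M.β_pos.le) h
  unfold premium
  linarith

/-- The upper bound `(1 + k₁) β / ζ₀` of the growth rate of the fortune. -/
noncomputable def growthRate (M : Model Ω P) : ℝ := (1 + M.k₁) * M.β / M.ζ₀

theorem growthRate_pos (M : Model Ω P) : 0 < M.growthRate :=
  div_pos (mul_pos (by linarith [M.k₁_nonneg]) M.β_pos) M.ζ₀_pos

theorem a_mul_premium_le (M : Model Ω P) (hf : ClaimFunction M.f) (u : ℝ) :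
    M.a * M.premium u ≤ M.growthRate := by
  refine (mul_le_mul_of_nonneg_left (M.premium_le hf u) (M.a_nonneg hf)).trans ?_
  -- For `ν = 0` the bound `a (1 + k₁) β ν` is zero; otherwise `ν` cancels against `a = 1 / (ζ₀ ν)`.
  rcases (M.ν_nonneg hf).eq_or_lt with h | h
  · rw [← h, mul_zero, mul_zero]
    exact M.growthRate_pos.le
  · have := M.ζ₀_pos
    unfold a growthRate
    apply le_of_eq
    field_simp

variable [P.IsComplete] {M : Model Ω P} {u₀ : ℝ} {x : ℝ≥0} {s : M.Strategy u₀}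
  {X : ℝ≥0 → Ω → ℝ}

/-- For an admissible strategy the fortune never becomes negative. -/
theorem IsFortune.ae_nonneg [SFinite P] (hX : M.IsFortune x s X) (ha : M.IsAdmissible s X) :
    ∀ᵐ ω ∂P, ∀ t, 0 ≤ X t ω := by
  have h := Measure.ae_ae_of_ae_prod ((Measure.measurePreserving_swap
    (μ := P) (ν := volume.restrict (Ici (0 : ℝ)))).quasiMeasurePreserving.ae ha)
  filter_upwards [h] with ω hω
  refine (hX.cadlag ω).nonneg_of_ae_leftLim_nonneg ?_
  filter_upwards [hω] with t ht
  -- Jumps of `L` are nonnegative, so admissibility forces `X_{t-} ≥ 0`.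
  exact (sub_nonneg.2 ((s.path_L ω).mono.leftLim_le le_rfl)).trans ht

/-- The claims are nonnegative and can be dropped; since `X ≥ 0`, the bound on `a p(u)` controls the
premium income. -/
theorem IsFortune.ae_add_dividends_le (hf : ClaimFunction M.f) (hX : M.IsFortune x s X)
    (h0 : ∀ᵐ ω ∂P, ∀ t, 0 ≤ X t ω) :
    ∀ᵐ ω ∂P, ∀ t : ℝ≥0,
      X t ω + s.L t ω ≤ x + M.growthRate * ∫ v in (0 : ℝ)..t, X v.toNNReal ω := by
  filter_upwards [hX.equation, h0] with ω hω h0 t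
  have hclaims : 0 ≤ ∫ z in Iic t ×ˢ univ,
      M.f (max 0 (M.a * Function.leftLim (fun v => X v ω) z.1)) (min z.2 (s.u z.1 ω))
        ∂M.claimMeasure ω :=
    integral_nonneg fun z => hf.nonneg _ (le_max_left _ _) _
  have hgrowth : M.a * (∫ v in (0 : ℝ)..t, X v.toNNReal ω * M.premium (s.u v.toNNReal ω))
      ≤ M.growthRate * ∫ v in (0 : ℝ)..t, X v.toNNReal ω := by
    rw [← intervalIntegral.integral_const_mul, ← intervalIntegral.integral_const_mul,
      intervalIntegral.integral_of_le t.coe_nonneg, intervalIntegral.integral_of_le t.coe_nonneg]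
    have hi : IntegrableOn (fun v : ℝ => M.growthRate * X v.toNNReal ω) (Ioc 0 t) :=
      ((((hX.cadlag ω).locallyIntegrable_toNNReal.integrableOn_isCompact
        isCompact_Icc).mono_set Ioc_subset_Icc_self).const_mul _)
    by_cases hint : IntegrableOn
        (fun v : ℝ => M.a * (X v.toNNReal ω * M.premium (s.u v.toNNReal ω))) (Ioc 0 t)
    · refine integral_mono hint hi fun v => ?_
      have := mul_le_mul_of_nonneg_left (M.a_mul_premium_le hf (s.u v.toNNReal ω))
        (h0 v.toNNReal)
      dsimp only
      linarith
    · rw [integral_undef hint]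
      exact integral_nonneg fun v => mul_nonneg M.growthRate_pos.le (h0 _)
  rw [hω t]
  linarith

theorem IsFortune.payoff_le [IsProbabilityMeasure P] (hf : ClaimFunction M.f)
    (hr : M.growthRate ≤ M.r) (hX : M.IsFortune x s X) (ha : M.IsAdmissible s X) :
    M.payoff s X ≤ x := by
  have h0 := hX.ae_nonneg ha
  have hle : ∀ᵐ ω ∂P, ∫⁻ t in {t : ℝ | 0 ≤ t ∧ ENNReal.ofReal t ≤ ruinTime X ω},
      ENNReal.ofReal (Real.exp (-(M.r * t))) ∂(s.path_L ω).stieltjes.measure ≤ x := by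
    filter_upwards [h0, hX.ae_add_dividends_le hf h0] with ω h0 hω
    -- The bound holds even for dividends over all of `[0, ∞)`, so ruin can be ignored.
    refine (lintegral_mono_set fun t ht => ht.1).trans ?_
    have := (s.path_L ω).lintegral_exp_neg_le (hX.cadlag ω) h0 x.2 M.growthRate_pos.le hr
      (M.growthRate_pos.trans_le hr) hω
    rwa [NNReal.val_eq_coe, ENNReal.ofReal_coe_nnreal] at this
  refine (lintegral_mono_ae hle).trans ?_
  simp

/-- The strategy that pays `x` at time `0` and nothing later, at the constant retention level
`u₀`. -/
noncomputable def Strategy.payAll (M : Model Ω P) (u₀ : ℝ) (x : ℝ≥0) : M.Strategy u₀ where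
  u _ _ := u₀
  L _ _ := x
  progressive_u := isStronglyProgressive_const _ _
  le_u _ _ := le_rfl
  adapted_L := stronglyAdapted_const _ _
  path_L _ := ⟨monotone_const, fun _ => continuousWithinAt_const, x.2⟩

theorem isFortune_payAll (hf : ClaimFunction M.f) (hu₀ : 0 ≤ u₀) :
    M.IsFortune x (Strategy.payAll M u₀ x) fun _ _ => 0 where
  adapted := stronglyAdapted_const _ _
  cadlag _ t := ⟨continuousWithinAt_const, 0, tendsto_const_nhds⟩
  equation := by
    refine Eventually.of_forall fun ω t => ?_
    have hB : ∀ᵐ z ∂M.claimMeasure ω, z.2 ∈ M.B := by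
      filter_upwards [ae_restrict_mem (MeasurableSet.univ.prod M.measurableSet_B)] with z hz
      exact hz.2
    have h0 : ∫ z in Iic t ×ˢ univ,
        M.f (max 0 (M.a * Function.leftLim (fun _ : ℝ≥0 => (0 : ℝ)) z.1)) (min z.2 u₀)
          ∂M.claimMeasure ω = 0 := by
      refine integral_eq_zero_of_ae ?_
      -- `f(0, ·)` is known to vanish only at nonnegative arguments, hence the use of `B ⊆ (0, ∞)`
      -- and `u₀ ≥ 0`.
      filter_upwards [ae_restrict_of_ae hB] with z hz
      rw [leftLim_const, mul_zero, max_self]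
      exact hf.zero_left _ (le_min (M.B_subset hz).le hu₀)
    simp only [Strategy.payAll, h0]
    simp

/-- On `ℝ≥0` the left limit at `0` is the value there, so the initial payment is not seen as a jump;
time `0` is `dt`-null in any case. -/
theorem isAdmissible_payAll : M.IsAdmissible (Strategy.payAll M u₀ x) fun _ _ => 0 := by
  refine Eventually.of_forall fun z => ?_
  simp only [Strategy.payAll, leftLim_const, sub_self, le_refl]

/-- Ruin occurs at time `0`, so the integral reduces to the undiscounted mass `x` that `dL` puts at
`{0}`. -/
theorem payoff_payAll [IsProbabilityMeasure P] :
    M.payoff (Strategy.payAll M u₀ x) (fun _ _ => 0) = x := by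
  have hset : ∀ ω : Ω, {t : ℝ | 0 ≤ t ∧ ENNReal.ofReal t ≤ ruinTime (fun _ _ => 0) ω} =
      Icc 0 0 := by
    intro ω
    have h0 : ruinTime (fun (_ : ℝ≥0) (_ : Ω) => 0) ω = 0 :=
      nonpos_iff_eq_zero.1 (iInf₂_le_of_le (0 : ℝ≥0) le_rfl le_rfl)
    ext t
    simp only [h0, mem_ofPred_eq, mem_Icc, ENNReal.ofReal_eq_zero, nonpos_iff_eq_zero]
  unfold payoff
  simp only [hset]
  have hin : ∀ ω, ∫⁻ t in Icc (0 : ℝ) 0, ENNReal.ofReal (Real.exp (-(M.r * t)))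
      ∂((Strategy.payAll M u₀ x).path_L ω).stieltjes.measure = x := by
    intro ω
    have h1 := ((Strategy.payAll M u₀ x).path_L ω).measure_Icc_zero 0 le_rfl
    rw [setLIntegral_congr_fun (g := fun _ => 1) measurableSet_Icc, setLIntegral_one, h1]
    · exact ENNReal.ofReal_coe_nnreal
    · intro t ht
      rw [Icc_self, mem_singleton_iff] at ht
      simp [ht]
  simp only [hin, lintegral_const, measure_univ, mul_one]

/-- If the discount rate is at least the maximal growth rate of the fortune, it is optimal to pay
out the whole fortune at once. -/
theorem value_eq [IsProbabilityMeasure P] (M : Model Ω P) (hf : ClaimFunction M.f) (hu₀ : 0 ≤ u₀)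
    (hr : M.growthRate ≤ M.r) (x : ℝ≥0) : M.value u₀ x = x := by
  refine le_antisymm (iSup₂_le fun s X => iSup₂_le fun hX ha => hX.payoff_le hf hr ha) ?_
  rw [← payoff_payAll (M := M) (u₀ := u₀) (x := x)]
  exact le_iSup₂_of_le _ _ (le_iSup₂_of_le (isFortune_payAll hf hu₀) isAdmissible_payAll le_rfl)

end Model

end Insurance

theorem mainTheorem3 {Ω : Type*} [MeasurableSpace Ω] (P : Measure Ω) [IsProbabilityMeasure P]
    [P.IsComplete] (M : Insurance.Model Ω P) (hf : Insurance.ClaimFunction M.f)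
    (u₀ : ℝ) (hu₀ : M.IsRetentionBound u₀)
    (hr : 2 * (1 + M.k₁) * M.β / M.ζ₀ < M.r) :
    Monotone (M.value u₀) ∧
    (∃ K : ℝ, 0 < K ∧ ∀ x : ℝ≥0, M.value u₀ x ≤ ENNReal.ofReal (K * x)) ∧
    (∃ C : ℝ≥0, LipschitzWith C fun x : ℝ≥0 => (M.value u₀ x).toReal) ∧
    (∀ x x' : ℝ≥0, 0 < x →
      (M.value u₀ (x + x')).toReal ≤ ((x + x') / x : ℝ) * (M.value u₀ x).toReal) := by
  -- (A2) reads `2 c < r` with `c > 0` the growth rate.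
  have hr' : M.growthRate ≤ M.r := by
    have h : 2 * (1 + M.k₁) * M.β / M.ζ₀ = 2 * M.growthRate := by
      unfold Insurance.Model.growthRate
      ring
    linarith [M.growthRate_pos]
  have hV : M.value u₀ = fun x : ℝ≥0 => (x : ℝ≥0∞) := funext (M.value_eq hf hu₀.1.le hr')
  simp only [hV, ENNReal.coe_toReal]
  refine ⟨ENNReal.coe_mono, ⟨1, one_pos, fun x => ?_⟩, ⟨1, LipschitzWith.subtype_val _⟩,
    fun x x' hx => ?_⟩
  · rw [one_mul, ENNReal.ofReal_coe_nnreal]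
  · rw [div_mul_cancel₀ _ (NNReal.coe_pos.2 hx).ne', NNReal.coe_add]
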